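/- Let $p_1,p_2$ be nonnegative integers, $p_3=\min(p_1,p_2)$, $p_4=\max(p_1,p_2)$, and let $f:\mathbb{R}\to\mathbb{R}$ be twice continuously differentiable. For $B\in\mathbb{R}^{p_1\times p_2}$ with singular values $\sigma_1(B),\dots,\sigma_{p_3}(B)\ge 0$ put $R(B)=\sum_{j=1}^{p_3} f(\sigma_j(B))$, regarded as a function of $\mathrm{vec}(B)\in\mathbb{R}^{p_1p_2}$, the vector of all entries of $B$. Let $B=U\,\mathrm{diag}[\sigma]\,V^\top$ be a singular value decomposition of $B$: $U\in\mathbb{R}^{p_1\times p_1}$ and $V\in\mathbb{R}^{p_2\times p_2}$ are orthogonal, $\sigma=(\sigma_1,\dots,\sigma_{p_3})$ has nonnegative entries (in any order), and $\mathrm{diag}[\sigma]$ is the $p_1\times p_2$ matrix with $\sigma$ on its main diagonal and zeros elsewhere. Assume that the $\sigma_j$ are pairwise distinct and nonzero. Then $R$ is twice continuously differentiable in a neighbourhood of $B$, and its Hessian matrix (the $p_1p_2\times p_1p_2$ matrix of second partial derivatives with respect to the entries of the matrix) satisfies $$\nabla^2R(B)=Q\begin{bmatrix}A_1&0&0\\0&A_2&0\\0&0&A_3\end{bmatrix}Q^\top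 .$$ Here the rows and columns of the block matrix, and the columns of $Q$, are labelled by the pairs $(s,t)$, $1\le s\le p_1$, $1\le t\le p_2$. The matrix $Q$ is orthogonal, with columns $Q_{\cdot,st}=\mathrm{vec}(u_sv_t^\top)$, where $u_s$ and $v_t$ are the $s$-th column of $U$ and the $t$-th column of $V$. The blocks are as follows. * $A_1\in\mathbb{R}^{p_3\times p_3}$ is labelled by the pairs $(s,s)$, $1\le s\le p_3$, and is diagonal with $A_{1,(ss,ss)}=f''(\sigma_s)$. * $A_2\in\mathbb{R}^{p_3(p_3-1)\times p_3(p_3-1)}$ is labelled by the pairs $(s,t)$ with $1\le s\ne t\le p_3$, and $$A_{2,(st,st)}=\frac{\sigma_sf'(\sigma_s)-\sigma_tf'(\sigma_t)}{\sigma_s^2-\sigma_t^2},\qquad A_{2,(st,ts)}=-\frac{\sigma_sf'(\sigma_t)-\sigma_tf'(\sigma_s)}{\sigma_s^2-\sigma_t^2},$$ all other entries being zero. * $A_3\in\mathbb{R}^{(p_4-p_3)p_3\times(p_4-p_3)p_3}$ is labelled by the remaining pairs, those with $s>p_3$ (when $p_1>p_2$) or $t>p_3$ (when $p_1<p_2$),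 and is diagonal with $A_{3,(st,st)}=f'(\sigma_m)/\sigma_m$, $m=\min(s,t)$; thus the entry is $f'(\sigma_t)/\sigma_t$ if $p_1>p_2$ and $f'(\sigma_s)/\sigma_s$ if $p_1<p_2$. -/

import Mathlib

noncomputable section

/-- Vectorization of a `p₁ × p₂` matrix: its entries, as one vector of `ℝ^(p₁p₂)` whose coordinates
are labelled by the positions `(i, j)`. -/
def vecop {p₁ p₂ : ℕ} (M : Matrix (Fin p₁) (Fin p₂) ℝ) : EuclideanSpace ℝ (Fin p₁ × Fin p₂) :=
  WithLp.toLp 2 fun q => M q.1 q.2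

/-- The inverse of vectorization. -/
def unvec {p₁ p₂ : ℕ} (x : EuclideanSpace ℝ (Fin p₁ × Fin p₂)) : Matrix (Fin p₁) (Fin p₂) ℝ :=
  Matrix.of fun i j => x (i, j)

/-- The Hessian matrix of `F : ℝ^ι → ℝ` at `x`, i.e. the matrix of second partial derivatives.
It is meaningful where `F` is twice differentiable. -/
def hessianMatrix {ι : Type*} [Fintype ι] [DecidableEq ι] (F : EuclideanSpace ℝ ι → ℝ)
    (x : EuclideanSpace ℝ ι) : Matrix ι ι ℝ :=
  Matrix.of fun a b =>
    fderiv ℝ (fderiv ℝ F) x (EuclideanSpace.single a 1) (EuclideanSpace.single b 1)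

/-- `R(B) = ∑_{j=1}^{min(p₁,p₂)} f(σ_j(B))`, the `σ_j(B)` being the singular values of `B`
(counted with multiplicity). -/
def singularValueSum {p₁ p₂ : ℕ} (f : ℝ → ℝ) (B : Matrix (Fin p₁) (Fin p₂) ℝ) : ℝ :=
  ∑ j ∈ Finset.range (min p₁ p₂), f ((Matrix.toEuclideanLin B).singularValues j)

/-- The `p₁ × p₂` matrix with `σ` on its main diagonal and `0` elsewhere. -/
def rectDiag {p₁ p₂ : ℕ} (σ : Fin (min p₁ p₂) → ℝ) : Matrix (Fin p₁) (Fin p₂) ℝ :=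
  Matrix.of fun i j =>
    if h : (i : ℕ) = (j : ℕ) then σ ⟨i, lt_min i.isLt (h ▸ j.isLt)⟩ else 0

/-- `B = U diag[σ] Vᵀ` is a (full) singular value decomposition. No ordering of `σ` is imposed. -/
structure IsSVD {p₁ p₂ : ℕ} (B : Matrix (Fin p₁) (Fin p₂) ℝ) (U : Matrix (Fin p₁) (Fin p₁) ℝ)
    (σ : Fin (min p₁ p₂) → ℝ) (V : Matrix (Fin p₂) (Fin p₂) ℝ) : Prop where
  left_orthogonal : U ∈ Matrix.orthogonalGroup (Fin p₁) ℝ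
  right_orthogonal : V ∈ Matrix.orthogonalGroup (Fin p₂) ℝ
  nonneg : ∀ j, 0 ≤ σ j
  eq : B = U * rectDiag σ * V.transpose

/-- Labels of the first block: the diagonal positions `(s, s)`, `s ≤ min(p₁,p₂)`. -/
abbrev Block1 (p₁ p₂ : ℕ) : Type := Fin (min p₁ p₂)

/-- Labels of the second block: `(s, t)` with `s ≠ t` and `s, t ≤ min(p₁,p₂)`. -/
abbrev Block2 (p₁ p₂ : ℕ) : Type := {q : Fin (min p₁ p₂) × Fin (min p₁ p₂) // q.1 ≠ q.2}

/-- Labels of the third block: positions `(s, t)` with `s > min(p₁,p₂)` (when `p₁ > p₂`) or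
`t > min(p₁,p₂)` (when `p₁ < p₂`); indices are counted from `0` here. -/
abbrev Block3 (p₁ p₂ : ℕ) : Type :=
  {q : Fin p₁ × Fin p₂ // min p₁ p₂ ≤ (q.1 : ℕ) ∨ min p₁ p₂ ≤ (q.2 : ℕ)}

/-- All labels, listed block by block. -/
abbrev BlockIndex (p₁ p₂ : ℕ) : Type := Block1 p₁ p₂ ⊕ Block2 p₁ p₂ ⊕ Block3 p₁ p₂

/-- The pair `(s, t)` that a label stands for. -/
def blockPos {p₁ p₂ : ℕ} : BlockIndex p₁ p₂ → Fin p₁ × Fin p₂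
  | Sum.inl s => (s.castLE (min_le_left p₁ p₂), s.castLE (min_le_right p₁ p₂))
  | Sum.inr (Sum.inl q) =>
      (q.1.1.castLE (min_le_left p₁ p₂), q.1.2.castLE (min_le_right p₁ p₂))
  | Sum.inr (Sum.inr q) => q.1

/-- The matrix `Q` whose column with label `(s, t)` is `vec(u_s v_tᵀ)`, where `u_s`, `v_t` are the
columns of `U` and `V`. -/
def basisMatrix {p₁ p₂ : ℕ} (U : Matrix (Fin p₁) (Fin p₁) ℝ) (V : Matrix (Fin p₂) (Fin p₂) ℝ) :
    Matrix (Fin p₁ × Fin p₂) (BlockIndex p₁ p₂) ℝ :=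
  Matrix.of fun a c =>
    vecop (Matrix.vecMulVec (U.col (blockPos c).1) (V.col (blockPos c).2)) a

/-- The first block: `f''(σ_s)` at `(ss, ss)`. -/
def blockA1 {p₁ p₂ : ℕ} (f : ℝ → ℝ) (σ : Fin (min p₁ p₂) → ℝ) :
    Matrix (Block1 p₁ p₂) (Block1 p₁ p₂) ℝ :=
  Matrix.diagonal fun s => deriv (deriv f) (σ s)

/-- The second block: its nonzero entries are at `(st, st)` and `(st, ts)`. -/
def blockA2 {p₁ p₂ : ℕ} (f : ℝ → ℝ) (σ : Fin (min p₁ p₂) → ℝ) :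
    Matrix (Block2 p₁ p₂) (Block2 p₁ p₂) ℝ :=
  Matrix.of fun a b =>
    let s := a.1.1
    let t := a.1.2
    if b.1 = (s, t) then
      (σ s * deriv f (σ s) - σ t * deriv f (σ t)) / (σ s ^ 2 - σ t ^ 2)
    else if b.1 = (t, s) then
      -((σ s * deriv f (σ t) - σ t * deriv f (σ s)) / (σ s ^ 2 - σ t ^ 2))
    else 0

/-- The third block: `f'(σ_m) / σ_m` at `(st, st)`, where `m = min(s, t)` is the one of the two
indices that does not exceed `min(p₁,p₂)` (so `m = t` when `p₁ ≥ p₂`). -/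
def blockA3 {p₁ p₂ : ℕ} (f : ℝ → ℝ) (σ : Fin (min p₁ p₂) → ℝ) :
    Matrix (Block3 p₁ p₂) (Block3 p₁ p₂) ℝ :=
  Matrix.diagonal fun q =>
    let m : Fin (min p₁ p₂) :=
      ⟨min (q.1.1 : ℕ) (q.1.2 : ℕ), min_lt_min q.1.1.isLt q.1.2.isLt⟩
    deriv f (σ m) / σ m

/-- The block-diagonal matrix `diag(A₁, A₂, A₃)`. -/
def blockMatrix {p₁ p₂ : ℕ} (f : ℝ → ℝ) (σ : Fin (min p₁ p₂) → ℝ) :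
    Matrix (BlockIndex p₁ p₂) (BlockIndex p₁ p₂) ℝ :=
  Matrix.fromBlocks (blockA1 f σ) 0 0 (Matrix.fromBlocks (blockA2 f σ) 0 0 (blockA3 f σ))

end

/-!
The Hermitian dilation of a `p₁ × p₂` matrix `X` is the symmetric matrix with blocks `0, X, Xᵀ, 0`.
It depends linearly on `X`, and for `X = B = U diag[σ] Vᵀ` the vector `(u_j, v_j)` is an eigenvector
for `σ_j`. As the `σ_j` are distinct and positive, this eigenvalue is simple
(`IsSVD.eq_smul_of_hermitianDilation_eq`), so by the implicit function theorem it extends to a smooth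
eigenvalue `l_j` of the dilation near `B`, with a smooth eigenvector `w_j`
(`exists_contDiffAt_eigenpair`). Near `B` the `l_j` stay distinct and positive; their squares are
eigenvalues of `XᵀX`, and as the rank is at most `min(p₁, p₂)` there is no room for further nonzero
singular values. Hence `R = ∑ f ∘ l_j` near `B` (`IsSVD.singularValueSum_eventuallyEq`), which gives
the regularity of `R`.

Write `A X` for the dilation. Since it is symmetric, `Dl_j(H) ‖w_j‖² = ⟪w_j, A H w_j⟫` near `B`, and
one more differentiation gives `D²l_j(K, H) ‖w_j‖² = 2 ⟪Dw_j(K), A H w_j⟫`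
(`fderiv_fderiv_eigenvalue_mul`). The vector `Dw_j(K)` is determined by the differentiated eigenvector
equation and the normalization of `w_j`. In the coordinates given by the columns of `U` and `V` that
equation splits into one `2 × 2` system for every `s ≠ j` below `min(p₁, p₂)`, with determinant
`σ_j² - σ_s²`, and scalar equations for the remaining indices
(`IsSVD.inner_hermitianDilation_eq_singularValueHessian`). The chain rule and a collection of terms
by the label of the coefficients of `K` yield the three blocks
(`sum_singularValueHessian_eq_dotProduct_blockMatrix`).
-/

section

open Filter Topology
open scoped Matrix Kronecker

/-! ### Smooth perturbation of a simple eigenvalue -/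

section SimpleEigenvalue

variable {X W : Type*} [NormedAddCommGroup X] [NormedSpace ℝ X]
  [NormedAddCommGroup W] [InnerProductSpace ℝ W]
  {A : X →L[ℝ] W →L[ℝ] W} {w : X → W} {l : X → ℝ} {x₀ : X}

/-- A simple eigenvalue of a symmetric operator, together with an eigenvector, extends smoothly to
nearby members of a linear family. The eigenvector is normalized by `⟪w₀, w x⟫ = ⟪w₀, w₀⟫`, which
unlike `‖w x‖ = ‖w₀‖` is affine in `w x`; it makes the derivative of `w` orthogonal to `w₀`. -/
theorem exists_contDiffAt_eigenpair [CompleteSpace X] [FiniteDimensional ℝ W]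
    {n : WithTop ℕ∞} (hn : n ≠ 0) {w₀ : W} {l₀ : ℝ}
    (hsymm : (A x₀ : W →ₗ[ℝ] W).IsSymmetric) (hw₀ : w₀ ≠ 0) (heig : A x₀ w₀ = l₀ • w₀)
    (hsimple : ∀ h, A x₀ h = l₀ • h → ∃ c : ℝ, h = c • w₀) :
    ∃ (w : X → W) (l : X → ℝ), ContDiffAt ℝ n w x₀ ∧ ContDiffAt ℝ n l x₀ ∧
      w x₀ = w₀ ∧ l x₀ = l₀ ∧
      ∀ᶠ x in 𝓝 x₀, A x (w x) = l x • w x ∧ inner ℝ w₀ (w x) = inner ℝ w₀ w₀ := by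
  -- The eigenpairs near `(w₀, l₀)` are the zeros of `Φ (x, ·)`, where `Φ` is the map below.
  let Φ : X × (W × ℝ) → W × ℝ := fun p =>
    (A p.1 p.2.1 - p.2.2 • p.2.1, inner ℝ w₀ p.2.1 - inner ℝ w₀ w₀)
  let u : X × (W × ℝ) := (x₀, (w₀, l₀))
  have hΦ : ContDiff ℝ n Φ := by
    refine ContDiff.prodMk ?_ ?_
    · exact ((A.contDiff.comp contDiff_fst).clm_apply (contDiff_fst.comp contDiff_snd)).sub
        ((contDiff_snd.comp contDiff_snd).smul (contDiff_fst.comp contDiff_snd))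
    · exact (contDiff_const.inner ℝ (contDiff_fst.comp contDiff_snd)).sub contDiff_const
  have hpartial : ∀ h : W, ∀ m : ℝ, (fderiv ℝ Φ u ∘L .inr ℝ X (W × ℝ)) (h, m) =
      (A x₀ h - l₀ • h - m • w₀, inner ℝ w₀ h) := by
    intro h m
    have h1 : HasFDerivAt Φ (fderiv ℝ Φ u) u := (hΦ.differentiable hn u).hasFDerivAt
    have h2 := (h1.comp_hasDerivAt_of_eq (0 : ℝ)
      (((hasDerivAt_id (0 : ℝ)).smul_const ((0 : X), (h, m))).const_add u) (by simp))
    have h3 : HasDerivAt (fun t : ℝ => Φ (u + t • ((0 : X), (h, m))))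
        (A x₀ h - l₀ • h - m • w₀, inner ℝ w₀ h) 0 := by
      have e : (fun t : ℝ => Φ (u + t • ((0 : X), (h, m)))) = fun t =>
          (A x₀ (w₀ + t • h) - (l₀ + t * m) • (w₀ + t • h),
            inner ℝ w₀ (w₀ + t • h) - inner ℝ w₀ w₀) := by
        funext t; simp [Φ, u]
      rw [e]
      have hv : HasDerivAt (fun t : ℝ => w₀ + t • h) h 0 := by
        simpa using ((hasDerivAt_id (0 : ℝ)).smul_const h).const_add w₀
      have hl : HasDerivAt (fun t : ℝ => l₀ + t * m) m 0 := by
        simpa using ((hasDerivAt_id (0 : ℝ)).mul_const m).const_add l₀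
      refine HasDerivAt.prodMk ?_ ?_
      · have := ((A x₀).hasFDerivAt.comp_hasDerivAt (0 : ℝ) hv).sub (hl.smul hv)
        convert! this using 1
        simp [sub_sub]
      · simpa using ((innerSL ℝ w₀).hasFDerivAt.comp_hasDerivAt (0 : ℝ) hv).sub_const
          (inner ℝ w₀ w₀)
    have := h2.unique h3
    simpa using this
  have hinv : (fderiv ℝ Φ u ∘L .inr ℝ X (W × ℝ)).IsInvertible := by
    set T := fderiv ℝ Φ u ∘L .inr ℝ X (W × ℝ)
    have hinj : Function.Injective T := by
      rw [injective_iff_map_eq_zero]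
      rintro ⟨h, m⟩ hz
      rw [hpartial, Prod.mk_eq_zero] at hz
      obtain ⟨h1, h2⟩ := hz
      have h0 : inner ℝ w₀ w₀ ≠ 0 := inner_self_ne_zero.mpr hw₀
      -- Pairing with `w₀` kills the range of `A x₀ - l₀`, which is symmetric.
      have hm : m = 0 := by
        have h3 : inner ℝ w₀ (A x₀ h) = l₀ * inner ℝ w₀ h := by
          have := hsymm w₀ h
          simp only [ContinuousLinearMap.coe_coe] at this
          rw [← this, heig, real_inner_smul_left]
        have h4 := congrArg (inner ℝ w₀) h1
        simp only [inner_sub_right, real_inner_smul_right, h3, h2, inner_zero_right] at h4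
        have : m * inner ℝ w₀ w₀ = 0 := by linarith
        exact (mul_eq_zero.mp this).resolve_right h0
      subst hm
      obtain ⟨c, rfl⟩ := hsimple h (by simpa [sub_eq_zero] using h1)
      rw [real_inner_smul_right] at h2
      simp [(mul_eq_zero.mp h2).resolve_right h0]
    refine ⟨(LinearEquiv.ofInjectiveEndo (T : W × ℝ →ₗ[ℝ] W × ℝ) hinj).toContinuousLinearEquiv,
      ?_⟩
    ext1 <;> ext <;> rfl
  let ψ := hΦ.contDiffAt.implicitFunction hn hinv
  have hψ : ContDiffAt ℝ n ψ x₀ := hΦ.contDiffAt.contDiffAt_implicitFunction hn hinv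
  have hψ₀ : ψ x₀ = (w₀, l₀) := hΦ.contDiffAt.implicitFunction_apply_self hn hinv
  refine ⟨fun x => (ψ x).1, fun x => (ψ x).2, hψ.fst, hψ.snd, congrArg Prod.fst hψ₀,
    congrArg Prod.snd hψ₀, ?_⟩
  filter_upwards [hΦ.contDiffAt.eventually_apply_implicitFunction hn hinv] with x hx
  have hx' : Φ (x, ψ x) = Φ u := hx
  simpa [Φ, u, heig, sub_eq_zero] using hx'

/-- Differentiating `A x (w x) = l x • w x`. -/
theorem apply_fderiv_eigenvector (hw : DifferentiableAt ℝ w x₀) (hl : DifferentiableAt ℝ l x₀)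
    (h : ∀ᶠ x in 𝓝 x₀, A x (w x) = l x • w x) (H : X) :
    A x₀ (fderiv ℝ w x₀ H) + A H (w x₀) = l x₀ • fderiv ℝ w x₀ H + fderiv ℝ l x₀ H • w x₀ := by
  have h1 := A.hasFDerivAt (x := x₀) |>.clm_apply hw.hasFDerivAt
  have h2 := hl.hasFDerivAt.smul hw.hasFDerivAt
  have h3 := (h1.congr_of_eventuallyEq (h.mono fun x hx => hx.symm)).unique h2
  simpa using congrArg (fun T : X →L[ℝ] W => T H) h3

/-- The first derivative of an eigenvalue; pairing with the eigenvector removes the derivative of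
the eigenvector because `A x₀` is symmetric. -/
theorem fderiv_eigenvalue_mul (hsymm : (A x₀ : W →ₗ[ℝ] W).IsSymmetric)
    (hw : DifferentiableAt ℝ w x₀) (hl : DifferentiableAt ℝ l x₀)
    (h : ∀ᶠ x in 𝓝 x₀, A x (w x) = l x • w x) (H : X) :
    fderiv ℝ l x₀ H * inner ℝ (w x₀) (w x₀) = inner ℝ (w x₀) (A H (w x₀)) := by
  have h1 := congrArg (inner ℝ (w x₀)) (apply_fderiv_eigenvector hw hl h H)
  have h2 := hsymm (w x₀) (fderiv ℝ w x₀ H)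
  simp only [ContinuousLinearMap.coe_coe] at h2
  simp only [inner_add_right, real_inner_smul_right, ← h2, h.self_of_nhds,
    real_inner_smul_left] at h1
  linarith

/-- The second derivative of an eigenvalue, from the first derivative of the eigenvector. It follows
by differentiating the first order formula `fderiv_eigenvalue_mul`, valid near `x₀`. -/
theorem fderiv_fderiv_eigenvalue_mul (hsymm : ∀ x, (A x : W →ₗ[ℝ] W).IsSymmetric)
    (hw : ContDiffAt ℝ 2 w x₀) (hl : ContDiffAt ℝ 2 l x₀)
    (h : ∀ᶠ x in 𝓝 x₀, A x (w x) = l x • w x)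
    (horth : ∀ K, inner ℝ (w x₀) (fderiv ℝ w x₀ K) = 0) (K H : X) :
    fderiv ℝ (fderiv ℝ l) x₀ K H * inner ℝ (w x₀) (w x₀) =
      2 * inner ℝ (fderiv ℝ w x₀ K) (A H (w x₀)) := by
  have hw1 := (hw.differentiableAt two_ne_zero).hasFDerivAt
  have key : (fun x => fderiv ℝ l x H * inner ℝ (w x) (w x)) =ᶠ[𝓝 x₀]
      fun x => inner ℝ (w x) (A H (w x)) := by
    filter_upwards [h.eventually_nhds, hw.eventually (by simp), hl.eventually (by simp)]
      with x hx hwx hlx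
    exact fderiv_eigenvalue_mul (hsymm x) (hwx.differentiableAt two_ne_zero)
      (hlx.differentiableAt two_ne_zero) hx H
  have hdl : HasFDerivAt (fderiv ℝ l) (fderiv ℝ (fderiv ℝ l) x₀) x₀ :=
    ((hl.fderiv_right (m := 1) (by norm_num)).differentiableAt one_ne_zero).hasFDerivAt
  have h1 := (hdl.clm_apply (hasFDerivAt_const H x₀)).mul (hw1.inner ℝ hw1)
  have h2 := hw1.inner ℝ ((A H).hasFDerivAt.comp x₀ hw1)
  have h3 := congrArg (fun T : X →L[ℝ] ℝ => T K)
    ((h1.congr_of_eventuallyEq key.symm).unique h2)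
  have h4 := hsymm H (w x₀) (fderiv ℝ w x₀ K)
  simp only [ContinuousLinearMap.coe_coe] at h4
  have h5 := horth K
  have h7 := real_inner_comm (fderiv ℝ w x₀ K) (A H (w x₀))
  simp [← h4, h7] at h3
  rw [h5, real_inner_comm, h5] at h3
  rw [real_inner_self_eq_norm_sq]
  linarith

theorem ContDiffAt.fderiv_fderiv_comp {f : ℝ → ℝ} (hf : ContDiff ℝ 2 f)
    (hl : ContDiffAt ℝ 2 l x₀) (K H : X) :
    fderiv ℝ (fderiv ℝ fun x => f (l x)) x₀ K H =
      deriv (deriv f) (l x₀) * (fderiv ℝ l x₀ K * fderiv ℝ l x₀ H) +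
        deriv f (l x₀) * fderiv ℝ (fderiv ℝ l) x₀ K H := by
  have key : (fderiv ℝ fun x => f (l x)) =ᶠ[𝓝 x₀] fun x => deriv f (l x) • fderiv ℝ l x := by
    filter_upwards [hl.eventually (by simp)] with x hx
    exact ((hf.differentiable two_ne_zero (l x)).hasDerivAt.comp_hasFDerivAt x
      (hx.differentiableAt two_ne_zero).hasFDerivAt).fderiv
  have hdl : HasFDerivAt (fderiv ℝ l) (fderiv ℝ (fderiv ℝ l) x₀) x₀ :=
    ((hl.fderiv_right (m := 1) (by norm_num)).differentiableAt one_ne_zero).hasFDerivAt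
  have hdf : HasDerivAt (deriv f) (deriv (deriv f) (l x₀)) (l x₀) :=
    (hf.differentiable_deriv_two (l x₀)).hasDerivAt
  have h := (hdf.comp_hasFDerivAt x₀
    (hl.differentiableAt two_ne_zero).hasFDerivAt).smul hdl
  rw [(h.congr_of_eventuallyEq key).fderiv]
  simp
  ring

end SimpleEigenvalue

/-! ### Singular values from eigenvectors of the Gram operator -/

/-- If `m` distinct positive numbers are square roots of eigenvalues of `T* T` and `T` has rank at
most `m`, then they are the first `m` singular values of `T`, up to order. -/
theorem LinearMap.sum_singularValues_eq_of_hasEigenvalue {E F : Type*}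
    [NormedAddCommGroup E] [InnerProductSpace ℝ E] [FiniteDimensional ℝ E]
    [NormedAddCommGroup F] [InnerProductSpace ℝ F] [FiniteDimensional ℝ F]
    (T : E →ₗ[ℝ] F) {m : ℕ} {s : Fin m → ℝ} (hs : Function.Injective s) (hpos : ∀ j, 0 < s j)
    (heig : ∀ j, Module.End.HasEigenvalue (LinearMap.adjoint T ∘ₗ T) (s j ^ 2))
    (hrank : Module.finrank ℝ (LinearMap.range T) ≤ m) (f : ℝ → ℝ) :
    ∑ i ∈ Finset.range m, f (T.singularValues i) = ∑ j, f (s j) := by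
  have hex : ∀ j, ∃ i : ℕ, T.singularValues i = s j := by
    intro j
    obtain ⟨i, hi⟩ := T.isSymmetric_adjoint_comp_self.exists_eigenvalues_eq rfl (heig j)
    refine ⟨i, ?_⟩
    rw [T.singularValues_fin rfl]
    have : T.isSymmetric_adjoint_comp_self.eigenvalues rfl i = s j ^ 2 := by exact_mod_cast hi
    rw [this, Real.sqrt_sq (hpos j).le]
  -- A positive singular value has an index below the rank, so `e` permutes `{0, …, m - 1}`.
  choose e he using hex
  have hlt : ∀ j, e j < m := fun j => by
    refine lt_of_lt_of_le ?_ hrank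
    rw [← T.singularValues_pos_iff_lt_finrank_range, he]
    exact hpos j
  have hinj : Function.Injective fun j => (⟨e j, hlt j⟩ : Fin m) := fun a b hab => by
    apply hs
    rw [← he, ← he, Fin.mk.inj_iff.mp hab]
  rw [Finset.sum_range fun i => f (T.singularValues i),
    ← (Finite.injective_iff_bijective.mp hinj).sum_comp]
  simp [he]

/-! ### The Hermitian dilation of a rectangular matrix -/

/-- The Hermitian dilation of a rectangular matrix `X`, i.e. the symmetric matrix with blocks
`0, X, Xᵀ, 0`, as a linear function of the vector of entries of `X`. -/
noncomputable def hermitianDilation (p₁ p₂ : ℕ) : EuclideanSpace ℝ (Fin p₁ × Fin p₂) →L[ℝ]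
    EuclideanSpace ℝ (Fin p₁ ⊕ Fin p₂) →L[ℝ] EuclideanSpace ℝ (Fin p₁ ⊕ Fin p₂) :=
  LinearMap.toContinuousLinearMap
    { toFun := fun x => Matrix.toEuclideanCLM (𝕜 := ℝ)
        (Matrix.fromBlocks 0 (unvec x) (unvec x).transpose 0)
      map_add' := fun x y => by
        rw [← map_add, Matrix.fromBlocks_add]
        congr 2 <;> ext <;> simp
      map_smul' := fun c x => by
        rw [RingHom.id_apply, ← map_smul, Matrix.fromBlocks_smul]
        congr 2 <;> ext <;> simp }

/-- The vector of `ℝ^(p₁ + p₂)` with components `a ∈ ℝ^p₁` and `b ∈ ℝ^p₂`. -/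
def sumVec {p₁ p₂ : ℕ} (a : Fin p₁ → ℝ) (b : Fin p₂ → ℝ) :
    EuclideanSpace ℝ (Fin p₁ ⊕ Fin p₂) :=
  WithLp.toLp 2 (Sum.elim a b)

section Dilation

variable {p₁ p₂ : ℕ}

theorem exists_eq_sumVec (w : EuclideanSpace ℝ (Fin p₁ ⊕ Fin p₂)) :
    ∃ a b, w = sumVec a b :=
  ⟨fun i => w (Sum.inl i), fun j => w (Sum.inr j), by ext (i | j) <;> rfl⟩

theorem sumVec_inj {a c : Fin p₁ → ℝ} {b d : Fin p₂ → ℝ} :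
    sumVec a b = sumVec c d ↔ a = c ∧ b = d := by
  simp [sumVec, Sum.elim_eq_iff]

theorem inner_sumVec (a c : Fin p₁ → ℝ) (b d : Fin p₂ → ℝ) :
    inner ℝ (sumVec a b) (sumVec c d) = a ⬝ᵥ c + b ⬝ᵥ d := by
  simp [sumVec, EuclideanSpace.inner_toLp_toLp, dotProduct_comm]

theorem add_sumVec (a c : Fin p₁ → ℝ) (b d : Fin p₂ → ℝ) :
    sumVec a b + sumVec c d = sumVec (a + c) (b + d) := by
  ext (i | j) <;> simp [sumVec]

theorem smul_sumVec (r : ℝ) (a : Fin p₁ → ℝ) (b : Fin p₂ → ℝ) :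
    r • sumVec a b = sumVec (r • a) (r • b) := by
  ext (i | j) <;> simp [sumVec]

theorem hermitianDilation_sumVec (x : EuclideanSpace ℝ (Fin p₁ × Fin p₂))
    (a : Fin p₁ → ℝ) (b : Fin p₂ → ℝ) :
    hermitianDilation p₁ p₂ x (sumVec a b) =
      sumVec (unvec x *ᵥ b) ((unvec x).transpose *ᵥ a) := by
  ext (i | j) <;>
    simp [hermitianDilation, sumVec, Matrix.toEuclideanCLM_toLp, Matrix.fromBlocks_mulVec]

theorem isSymmetric_hermitianDilation (x : EuclideanSpace ℝ (Fin p₁ × Fin p₂)) :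
    (hermitianDilation p₁ p₂ x :
      EuclideanSpace ℝ (Fin p₁ ⊕ Fin p₂) →ₗ[ℝ] _).IsSymmetric := by
  intro w z
  obtain ⟨a, b, rfl⟩ := exists_eq_sumVec w
  obtain ⟨c, d, rfl⟩ := exists_eq_sumVec z
  simp only [ContinuousLinearMap.coe_coe, hermitianDilation_sumVec, inner_sumVec]
  rw [Matrix.dotProduct_mulVec a, Matrix.dotProduct_mulVec b, Matrix.vecMul_transpose,
    Matrix.mulVec_transpose, add_comm]

/-- A nonzero eigenvalue `r` of the dilation gives the eigenvalue `r²` of the Gram operator. -/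
theorem hasEigenvalue_gram_of_hermitianDilation {x : EuclideanSpace ℝ (Fin p₁ × Fin p₂)}
    {w : EuclideanSpace ℝ (Fin p₁ ⊕ Fin p₂)} {r : ℝ} (hr : r ≠ 0) (hw : w ≠ 0)
    (h : hermitianDilation p₁ p₂ x w = r • w) :
    Module.End.HasEigenvalue (LinearMap.adjoint (Matrix.toEuclideanLin (unvec x)) ∘ₗ
      Matrix.toEuclideanLin (unvec x)) (r ^ 2) := by
  obtain ⟨a, b, rfl⟩ := exists_eq_sumVec w
  rw [hermitianDilation_sumVec, smul_sumVec, sumVec_inj] at h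
  -- As `r ≠ 0`, each of the two components determines the other.
  have hb : b ≠ 0 := by
    rintro rfl
    have ha : a = 0 := by simpa [hr] using h.1.symm
    apply hw
    ext (i | j) <;> simp [sumVec, ha]
  refine Module.End.hasEigenvalue_of_hasEigenvector (x := WithLp.toLp 2 b) ⟨?_, by simpa using hb⟩
  rw [Module.End.mem_eigenspace_iff, ← Matrix.toEuclideanLin_conjTranspose_eq_adjoint,
    LinearMap.comp_apply, Matrix.toLpLin_toLp, Matrix.toLpLin_toLp]
  simp [h.1, h.2, smul_smul, sq]

theorem finrank_range_toEuclideanLin_le (M : Matrix (Fin p₁) (Fin p₂) ℝ) :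
    Module.finrank ℝ (LinearMap.range (Matrix.toEuclideanLin M)) ≤ min p₁ p₂ := by
  exact le_min ((Submodule.finrank_le _).trans (by simp))
    ((LinearMap.finrank_range_le _).trans (by simp))

end Dilation

/-! ### Singular value decompositions -/

section SVD

variable {p₁ p₂ : ℕ}

/-- An index `s` below `min p₁ p₂`, as a row index. -/
abbrev leftIndex (s : Fin (min p₁ p₂)) : Fin p₁ := s.castLE (min_le_left p₁ p₂)

/-- An index `s` below `min p₁ p₂`, as a column index. -/
abbrev rightIndex (s : Fin (min p₁ p₂)) : Fin p₂ := s.castLE (min_le_right p₁ p₂)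

theorem Fin.exists_castLE_eq_or_le {m n : ℕ} (h : m ≤ n) (i : Fin n) :
    (∃ s : Fin m, s.castLE h = i) ∨ m ≤ (i : ℕ) := by
  rcases lt_or_ge (i : ℕ) m with hi | hi
  · exact .inl ⟨⟨i, hi⟩, rfl⟩
  · exact .inr hi

theorem Fin.sum_eq_sum_castLE_add {m n : ℕ} (h : m ≤ n) (g : Fin n → ℝ) :
    ∑ i, g i = ∑ s : Fin m, g (s.castLE h) + ∑ i ∈ Finset.univ.filter fun i : Fin n => m ≤ (i : ℕ), g i := by
  rw [← Finset.sum_filter_add_sum_filter_not Finset.univ (fun i : Fin n => (i : ℕ) < m)]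
  congr 1
  · refine (Finset.sum_bij (fun s _ => Fin.castLE h s) ?_ ?_ ?_ ?_).symm
    · simp
    · intro a _ b _ hab
      exact Fin.castLE_injective h hab
    · intro i hi
      exact ⟨⟨i, (Finset.mem_filter.mp hi).2⟩, Finset.mem_univ _, rfl⟩
    · simp
  · simp only [not_lt]

variable {B : Matrix (Fin p₁) (Fin p₂) ℝ} {U : Matrix (Fin p₁) (Fin p₁) ℝ}
  {σ : Fin (min p₁ p₂) → ℝ} {V : Matrix (Fin p₂) (Fin p₂) ℝ}

theorem rectDiag_mulVec_leftIndex (b : Fin p₂ → ℝ) (s : Fin (min p₁ p₂)) :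
    (rectDiag σ *ᵥ b) (leftIndex s) = σ s * b (rightIndex s) := by
  rw [Matrix.mulVec, dotProduct, Finset.sum_eq_single (rightIndex s)]
  · simp [rectDiag]
  · intro t _ ht
    have : (s : ℕ) ≠ t := fun h => ht (Fin.ext h.symm)
    simp [rectDiag, this]
  · simp

theorem rectDiag_mulVec_of_le (b : Fin p₂ → ℝ) {i : Fin p₁} (hi : min p₁ p₂ ≤ (i : ℕ)) :
    (rectDiag σ *ᵥ b) i = 0 := by
  rw [Matrix.mulVec, dotProduct]
  refine Finset.sum_eq_zero fun t _ => ?_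
  have : (i : ℕ) ≠ t := by omega
  simp [rectDiag, this]

theorem rectDiag_transpose_mulVec_rightIndex (a : Fin p₁ → ℝ) (s : Fin (min p₁ p₂)) :
    ((rectDiag σ)ᵀ *ᵥ a) (rightIndex s) = σ s * a (leftIndex s) := by
  rw [Matrix.mulVec, dotProduct, Finset.sum_eq_single (leftIndex s)]
  · simp [rectDiag]
  · intro i _ hi
    have : (i : ℕ) ≠ s := fun h => hi (Fin.ext h)
    simp [rectDiag, this]
  · simp

theorem rectDiag_transpose_mulVec_of_le (a : Fin p₁ → ℝ) {t : Fin p₂}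
    (ht : min p₁ p₂ ≤ (t : ℕ)) : ((rectDiag σ)ᵀ *ᵥ a) t = 0 := by
  rw [Matrix.mulVec, dotProduct]
  refine Finset.sum_eq_zero fun i _ => ?_
  have : (i : ℕ) ≠ t := by omega
  simp [rectDiag, this]

theorem Matrix.transpose_mul_self_of_mem_orthogonalGroup {n : ℕ} {U : Matrix (Fin n) (Fin n) ℝ}
    (hU : U ∈ Matrix.orthogonalGroup (Fin n) ℝ) : Uᵀ * U = 1 :=
  (Matrix.mem_orthogonalGroup_iff' (Fin n) ℝ).mp hU

theorem Matrix.self_mul_transpose_of_mem_orthogonalGroup {n : ℕ} {U : Matrix (Fin n) (Fin n) ℝ}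
    (hU : U ∈ Matrix.orthogonalGroup (Fin n) ℝ) : U * Uᵀ = 1 :=
  (Matrix.mem_orthogonalGroup_iff (Fin n) ℝ).mp hU

theorem Matrix.transpose_mulVec_col_of_mem_orthogonalGroup {n : ℕ}
    {U : Matrix (Fin n) (Fin n) ℝ} (hU : U ∈ Matrix.orthogonalGroup (Fin n) ℝ) (j : Fin n) :
    Uᵀ *ᵥ U.col j = Pi.single j 1 := by
  rw [← Matrix.mulVec_single_one, Matrix.mulVec_mulVec,
    Matrix.transpose_mul_self_of_mem_orthogonalGroup hU, Matrix.one_mulVec]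

theorem Matrix.transpose_mulVec_injective_of_mem_orthogonalGroup {n : ℕ}
    {U : Matrix (Fin n) (Fin n) ℝ} (hU : U ∈ Matrix.orthogonalGroup (Fin n) ℝ) :
    Function.Injective (Uᵀ *ᵥ · : (Fin n → ℝ) → Fin n → ℝ) := by
  intro a c h
  have := congrArg (U *ᵥ ·) h
  simpa [Matrix.mulVec_mulVec, Matrix.self_mul_transpose_of_mem_orthogonalGroup hU] using this

theorem Matrix.dotProduct_eq_transpose_mulVec_of_mem_orthogonalGroup {n : ℕ}
    {U : Matrix (Fin n) (Fin n) ℝ} (hU : U ∈ Matrix.orthogonalGroup (Fin n) ℝ)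
    (a c : Fin n → ℝ) : a ⬝ᵥ c = (Uᵀ *ᵥ a) ⬝ᵥ (Uᵀ *ᵥ c) := by
  rw [Matrix.mulVec_transpose, ← Matrix.dotProduct_mulVec, Matrix.mulVec_mulVec,
    Matrix.self_mul_transpose_of_mem_orthogonalGroup hU, Matrix.one_mulVec]

namespace IsSVD

theorem transpose_mulVec_mulVec (hB : IsSVD B U σ V) (b : Fin p₂ → ℝ) :
    Uᵀ *ᵥ (B *ᵥ b) = rectDiag σ *ᵥ (Vᵀ *ᵥ b) := by
  rw [hB.eq, Matrix.mulVec_mulVec, Matrix.mulVec_mulVec, ← Matrix.mul_assoc, ← Matrix.mul_assoc,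
    Matrix.transpose_mul_self_of_mem_orthogonalGroup hB.left_orthogonal, Matrix.one_mul]

theorem transpose_mulVec_transpose_mulVec (hB : IsSVD B U σ V) (a : Fin p₁ → ℝ) :
    Vᵀ *ᵥ (Bᵀ *ᵥ a) = (rectDiag σ)ᵀ *ᵥ (Uᵀ *ᵥ a) := by
  rw [hB.eq, Matrix.mulVec_mulVec, Matrix.mulVec_mulVec, Matrix.transpose_mul,
    Matrix.transpose_mul, Matrix.transpose_transpose, ← Matrix.mul_assoc, ← Matrix.mul_assoc,
    Matrix.transpose_mul_self_of_mem_orthogonalGroup hB.right_orthogonal, Matrix.one_mul]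

theorem mulVec_col (hB : IsSVD B U σ V) (j : Fin (min p₁ p₂)) :
    B *ᵥ V.col (rightIndex j) = σ j • U.col (leftIndex j) := by
  apply Matrix.transpose_mulVec_injective_of_mem_orthogonalGroup hB.left_orthogonal
  simp only [hB.transpose_mulVec_mulVec, Matrix.mulVec_smul,
    Matrix.transpose_mulVec_col_of_mem_orthogonalGroup hB.left_orthogonal,
    Matrix.transpose_mulVec_col_of_mem_orthogonalGroup hB.right_orthogonal]
  ext i
  obtain ⟨s, rfl⟩ | hi := Fin.exists_castLE_eq_or_le (min_le_left p₁ p₂) i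
  · rw [rectDiag_mulVec_leftIndex]
    by_cases h : s = j <;> simp [h]
  · have : i ≠ leftIndex j := by
      rintro rfl
      exact absurd j.isLt (not_lt.mpr hi)
    rw [rectDiag_mulVec_of_le _ hi]
    simp [this]

theorem transpose_mulVec_col (hB : IsSVD B U σ V) (j : Fin (min p₁ p₂)) :
    Bᵀ *ᵥ U.col (leftIndex j) = σ j • V.col (rightIndex j) := by
  apply Matrix.transpose_mulVec_injective_of_mem_orthogonalGroup hB.right_orthogonal
  simp only [hB.transpose_mulVec_transpose_mulVec, Matrix.mulVec_smul,
    Matrix.transpose_mulVec_col_of_mem_orthogonalGroup hB.left_orthogonal,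
    Matrix.transpose_mulVec_col_of_mem_orthogonalGroup hB.right_orthogonal]
  ext i
  obtain ⟨s, rfl⟩ | hi := Fin.exists_castLE_eq_or_le (min_le_right p₁ p₂) i
  · rw [rectDiag_transpose_mulVec_rightIndex]
    by_cases h : s = j <;> simp [h]
  · have : i ≠ rightIndex j := by
      rintro rfl
      exact absurd j.isLt (not_lt.mpr hi)
    rw [rectDiag_transpose_mulVec_of_le _ hi]
    simp [this]

theorem hermitianDilation_col (hB : IsSVD B U σ V) (j : Fin (min p₁ p₂)) :
    hermitianDilation p₁ p₂ (vecop B) (sumVec (U.col (leftIndex j)) (V.col (rightIndex j))) =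
      σ j • sumVec (U.col (leftIndex j)) (V.col (rightIndex j)) := by
  have : unvec (vecop B) = B := rfl
  rw [hermitianDilation_sumVec, smul_sumVec, this, hB.mulVec_col, hB.transpose_mulVec_col]

/-- `σ j` is a simple eigenvalue of the dilation: in the coordinates given by `U` and `V` the
eigenvector equation splits into `2 × 2` systems of determinant `σ s ^ 2 - σ j ^ 2`, and for indices
beyond `min p₁ p₂` it says that `σ j` times the coordinate vanishes. -/
theorem eq_smul_of_hermitianDilation_eq (hB : IsSVD B U σ V) (hinj : Function.Injective σ)
    (hpos : ∀ j, 0 < σ j) (j : Fin (min p₁ p₂)) (w : EuclideanSpace ℝ (Fin p₁ ⊕ Fin p₂))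
    (hw : hermitianDilation p₁ p₂ (vecop B) w = σ j • w) :
    ∃ c : ℝ, w = c • sumVec (U.col (leftIndex j)) (V.col (rightIndex j)) := by
  obtain ⟨a, b, rfl⟩ := exists_eq_sumVec w
  have hBB : unvec (vecop B) = B := rfl
  rw [hermitianDilation_sumVec, smul_sumVec, sumVec_inj, hBB] at hw
  obtain ⟨h1, h2⟩ := hw
  have e1 := hB.transpose_mulVec_mulVec b
  have e2 := hB.transpose_mulVec_transpose_mulVec a
  rw [h1, Matrix.mulVec_smul] at e1
  rw [h2, Matrix.mulVec_smul] at e2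
  have hj := (hpos j).ne'
  have hs : ∀ s, s ≠ j → (Uᵀ *ᵥ a) (leftIndex s) = 0 ∧ (Vᵀ *ᵥ b) (rightIndex s) = 0 := by
    intro s hsj
    have f1 := congrFun e1 (leftIndex s)
    have f2 := congrFun e2 (rightIndex s)
    rw [rectDiag_mulVec_leftIndex] at f1
    rw [rectDiag_transpose_mulVec_rightIndex] at f2
    simp only [Pi.smul_apply, smul_eq_mul] at f1 f2
    have hd : σ j ^ 2 - σ s ^ 2 ≠ 0 := by
      rw [sub_ne_zero, Ne, sq_eq_sq₀ (hpos j).le (hpos s).le]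
      exact fun h => hsj (hinj h.symm)
    constructor
    · refine (mul_eq_zero.mp ?_).resolve_left hd
      linear_combination σ j * f1 + σ s * f2
    · refine (mul_eq_zero.mp ?_).resolve_left hd
      linear_combination σ s * f1 + σ j * f2
  have hjj : (Vᵀ *ᵥ b) (rightIndex j) = (Uᵀ *ᵥ a) (leftIndex j) := by
    have f1 := congrFun e1 (leftIndex j)
    rw [rectDiag_mulVec_leftIndex] at f1
    exact (mul_left_cancel₀ hj f1).symm
  refine ⟨(Uᵀ *ᵥ a) (leftIndex j), ?_⟩
  rw [smul_sumVec, sumVec_inj]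
  constructor
  · apply Matrix.transpose_mulVec_injective_of_mem_orthogonalGroup hB.left_orthogonal
    simp only [Matrix.mulVec_smul,
      Matrix.transpose_mulVec_col_of_mem_orthogonalGroup hB.left_orthogonal]
    ext i
    obtain ⟨s, rfl⟩ | hi := Fin.exists_castLE_eq_or_le (min_le_left p₁ p₂) i
    · by_cases h : s = j
      · simp [h]
      · simpa [Pi.single_apply, h] using (hs s h).1
    · have : i ≠ leftIndex j := by
        rintro rfl
        exact absurd j.isLt (not_lt.mpr hi)
      have f1 := congrFun e1 i
      rw [rectDiag_mulVec_of_le _ hi] at f1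
      simpa [this, hj] using f1
  · apply Matrix.transpose_mulVec_injective_of_mem_orthogonalGroup hB.right_orthogonal
    simp only [Matrix.mulVec_smul,
      Matrix.transpose_mulVec_col_of_mem_orthogonalGroup hB.right_orthogonal]
    ext i
    obtain ⟨s, rfl⟩ | hi := Fin.exists_castLE_eq_or_le (min_le_right p₁ p₂) i
    · by_cases h : s = j
      · simp [h, hjj]
      · simpa [Pi.single_apply, h] using (hs s h).2
    · have : i ≠ rightIndex j := by
        rintro rfl
        exact absurd j.isLt (not_lt.mpr hi)
      have f1 := congrFun e2 i
      rw [rectDiag_transpose_mulVec_of_le _ hi] at f1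
      simpa [this, hj] using f1

/-! ### Perturbation of a singular value -/

/-- The Hessian of the `j`-th singular value at a matrix with singular values `σ`, as a bilinear form
in `k` and `h`, the two directions written in the coordinates given by the singular vectors. -/
noncomputable def singularValueHessian (σ : Fin (min p₁ p₂) → ℝ) (k h : Matrix (Fin p₁) (Fin p₂) ℝ)
    (j : Fin (min p₁ p₂)) : ℝ :=
  (∑ s ∈ Finset.univ.erase j,
    ((σ j * k (leftIndex s) (rightIndex j) + σ s * k (leftIndex j) (rightIndex s)) *
        h (leftIndex s) (rightIndex j) +
      (σ j * k (leftIndex j) (rightIndex s) + σ s * k (leftIndex s) (rightIndex j)) *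
        h (leftIndex j) (rightIndex s)) / (σ j ^ 2 - σ s ^ 2)) +
  (∑ i ∈ Finset.univ.filter fun i : Fin p₁ => min p₁ p₂ ≤ (i : ℕ), k i (rightIndex j) * h i (rightIndex j) / σ j) +
  ∑ t ∈ Finset.univ.filter fun t : Fin p₂ => min p₁ p₂ ≤ (t : ℕ), k (leftIndex j) t * h (leftIndex j) t / σ j

theorem transpose_mulVec_mulVec_col (U : Matrix (Fin p₁) (Fin p₁) ℝ)
    (V : Matrix (Fin p₂) (Fin p₂) ℝ) (H : Matrix (Fin p₁) (Fin p₂) ℝ) (i : Fin p₁) (t : Fin p₂) :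
    (Uᵀ *ᵥ (H *ᵥ V.col t)) i = (Uᵀ * H * V) i t := by
  rw [← Matrix.mulVec_single_one, Matrix.mulVec_mulVec, Matrix.mulVec_mulVec,
    Matrix.mulVec_single_one]
  rfl

theorem transpose_mulVec_transpose_mulVec_col (U : Matrix (Fin p₁) (Fin p₁) ℝ)
    (V : Matrix (Fin p₂) (Fin p₂) ℝ) (H : Matrix (Fin p₁) (Fin p₂) ℝ) (i : Fin p₁) (t : Fin p₂) :
    (Vᵀ *ᵥ (Hᵀ *ᵥ U.col i)) t = (Uᵀ * H * V) i t := by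
  rw [transpose_mulVec_mulVec_col, ← Matrix.transpose_apply (Uᵀ * H * V), Matrix.transpose_mul,
    Matrix.transpose_mul, Matrix.transpose_transpose, Matrix.mul_assoc]

theorem inner_sumVec_col (U : Matrix (Fin p₁) (Fin p₁) ℝ) (V : Matrix (Fin p₂) (Fin p₂) ℝ)
    (a : Fin p₁ → ℝ) (b : Fin p₂ → ℝ) (i : Fin p₁) (t : Fin p₂) :
    inner ℝ (sumVec (U.col i) (V.col t)) (sumVec a b) = (Uᵀ *ᵥ a) i + (Vᵀ *ᵥ b) t := by
  rw [inner_sumVec]; rfl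

/-- First order perturbation theory of a singular pair, at the singular value `σ j`. The hypotheses
`horth` and `hz` say that `z` is the derivative in direction `K` of the normalized eigenvector
of the dilation, and `r` that of the eigenvalue. Below `min p₁ p₂` the coordinates of `z` in the
bases of singular vectors solve `2 × 2` systems; beyond it, scalar equations. -/
theorem inner_hermitianDilation_eq_singularValueHessian (hB : IsSVD B U σ V)
    (hinj : Function.Injective σ) (hpos : ∀ j, 0 < σ j) (j : Fin (min p₁ p₂))
    (K H : EuclideanSpace ℝ (Fin p₁ × Fin p₂)) (z : EuclideanSpace ℝ (Fin p₁ ⊕ Fin p₂)) (r : ℝ)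
    (horth : inner ℝ (sumVec (U.col (leftIndex j)) (V.col (rightIndex j))) z = 0)
    (hz : hermitianDilation p₁ p₂ (vecop B) z + hermitianDilation p₁ p₂ K
        (sumVec (U.col (leftIndex j)) (V.col (rightIndex j))) =
      σ j • z + r • sumVec (U.col (leftIndex j)) (V.col (rightIndex j))) :
    inner ℝ z (hermitianDilation p₁ p₂ H
        (sumVec (U.col (leftIndex j)) (V.col (rightIndex j)))) =
      singularValueHessian σ (Uᵀ * unvec K * V) (Uᵀ * unvec H * V) j := by
  obtain ⟨a, b, rfl⟩ := exists_eq_sumVec z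
  rw [inner_sumVec_col] at horth
  have hBB : unvec (vecop B) = B := rfl
  simp only [hermitianDilation_sumVec, smul_sumVec, add_sumVec, sumVec_inj, hBB] at hz
  obtain ⟨h1, h2⟩ := hz
  have e1 := congrArg (Uᵀ *ᵥ ·) h1
  have e2 := congrArg (Vᵀ *ᵥ ·) h2
  simp only [Matrix.mulVec_add, Matrix.mulVec_smul, hB.transpose_mulVec_mulVec,
    hB.transpose_mulVec_transpose_mulVec,
    Matrix.transpose_mulVec_col_of_mem_orthogonalGroup hB.left_orthogonal,
    Matrix.transpose_mulVec_col_of_mem_orthogonalGroup hB.right_orthogonal] at e1 e2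
  rw [hermitianDilation_sumVec, inner_sumVec,
    Matrix.dotProduct_eq_transpose_mulVec_of_mem_orthogonalGroup hB.left_orthogonal,
    Matrix.dotProduct_eq_transpose_mulVec_of_mem_orthogonalGroup hB.right_orthogonal]
  set a' := Uᵀ *ᵥ a
  set b' := Vᵀ *ᵥ b
  set k := Uᵀ * unvec K * V with hk
  set h := Uᵀ * unvec H * V with hh
  have hj := (hpos j).ne'
  have f1 : ∀ i, (rectDiag σ *ᵥ b') i + k i (rightIndex j) =
      σ j * a' i + r * (Pi.single (leftIndex j) 1 : Fin p₁ → ℝ) i := by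
    intro i
    rw [hk, ← transpose_mulVec_mulVec_col]
    exact congrFun e1 i
  have f2 : ∀ t, ((rectDiag σ)ᵀ *ᵥ a') t + k (leftIndex j) t =
      σ j * b' t + r * (Pi.single (rightIndex j) 1 : Fin p₂ → ℝ) t := by
    intro t
    rw [hk, ← transpose_mulVec_transpose_mulVec_col]
    exact congrFun e2 t
  have hjj : a' (leftIndex j) = 0 ∧ b' (rightIndex j) = 0 := by
    have g1 := f1 (leftIndex j)
    have g2 := f2 (rightIndex j)
    rw [rectDiag_mulVec_leftIndex] at g1
    rw [rectDiag_transpose_mulVec_rightIndex] at g2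
    simp only [Pi.single_eq_same] at g1 g2
    have : σ j * (b' (rightIndex j) - a' (leftIndex j)) = 0 := by linarith
    have := (mul_eq_zero.mp this).resolve_left hj
    constructor <;> linarith
  have hs : ∀ s, s ≠ j →
      a' (leftIndex s) = (σ j * k (leftIndex s) (rightIndex j) +
        σ s * k (leftIndex j) (rightIndex s)) / (σ j ^ 2 - σ s ^ 2) ∧
      b' (rightIndex s) = (σ j * k (leftIndex j) (rightIndex s) +
        σ s * k (leftIndex s) (rightIndex j)) / (σ j ^ 2 - σ s ^ 2) := by
    intro s hsj
    have g1 := f1 (leftIndex s)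
    have g2 := f2 (rightIndex s)
    rw [rectDiag_mulVec_leftIndex] at g1
    rw [rectDiag_transpose_mulVec_rightIndex] at g2
    have n1 : leftIndex s ≠ leftIndex j := fun e => hsj (Fin.castLE_injective _ e)
    have n2 : rightIndex s ≠ rightIndex j := fun e => hsj (Fin.castLE_injective _ e)
    rw [Pi.single_eq_of_ne n1] at g1
    rw [Pi.single_eq_of_ne n2] at g2
    have hd : σ j ^ 2 - σ s ^ 2 ≠ 0 := by
      rw [sub_ne_zero, Ne, sq_eq_sq₀ (hpos j).le (hpos s).le]
      exact fun h => hsj (hinj h.symm)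
    constructor
    · rw [eq_div_iff hd]
      linear_combination -σ j * g1 - σ s * g2
    · rw [eq_div_iff hd]
      linear_combination -σ s * g1 - σ j * g2
  have ha : ∀ i : Fin p₁, min p₁ p₂ ≤ (i : ℕ) → a' i = k i (rightIndex j) / σ j := by
    intro i hi
    have n1 : i ≠ leftIndex j := by
      rintro rfl
      exact absurd j.isLt (not_lt.mpr hi)
    have g1 := f1 i
    rw [rectDiag_mulVec_of_le _ hi, Pi.single_eq_of_ne n1] at g1
    rw [eq_div_iff hj]
    linarith
  have hb : ∀ t : Fin p₂, min p₁ p₂ ≤ (t : ℕ) → b' t = k (leftIndex j) t / σ j := by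
    intro t ht
    have n1 : t ≠ rightIndex j := by
      rintro rfl
      exact absurd j.isLt (not_lt.mpr ht)
    have g1 := f2 t
    rw [rectDiag_transpose_mulVec_of_le _ ht, Pi.single_eq_of_ne n1] at g1
    rw [eq_div_iff hj]
    linarith
  rw [dotProduct, dotProduct, Fin.sum_eq_sum_castLE_add (min_le_left p₁ p₂),
    Fin.sum_eq_sum_castLE_add (min_le_right p₁ p₂), singularValueHessian]
  simp only [transpose_mulVec_transpose_mulVec_col]
  simp only [transpose_mulVec_mulVec_col, ← hh]
  rw [← Finset.add_sum_erase _ _ (Finset.mem_univ j),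
    ← Finset.add_sum_erase _ _ (Finset.mem_univ j)]
  have c1 : ∑ s ∈ Finset.univ.erase j,
      ((σ j * k (leftIndex s) (rightIndex j) + σ s * k (leftIndex j) (rightIndex s)) *
          h (leftIndex s) (rightIndex j) +
        (σ j * k (leftIndex j) (rightIndex s) + σ s * k (leftIndex s) (rightIndex j)) *
          h (leftIndex j) (rightIndex s)) / (σ j ^ 2 - σ s ^ 2) =
      ∑ s ∈ Finset.univ.erase j, a' (leftIndex s) * h (leftIndex s) (rightIndex j) +
      ∑ s ∈ Finset.univ.erase j, b' (rightIndex s) * h (leftIndex j) (rightIndex s) := by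
    rw [← Finset.sum_add_distrib]
    refine Finset.sum_congr rfl fun s hs' => ?_
    obtain ⟨i1, i2⟩ := hs s (Finset.ne_of_mem_erase hs')
    rw [i1, i2]
    ring
  have c2 : ∑ i ∈ Finset.univ.filter fun i : Fin p₁ => min p₁ p₂ ≤ (i : ℕ),
        k i (rightIndex j) * h i (rightIndex j) / σ j =
      ∑ i ∈ Finset.univ.filter fun i : Fin p₁ => min p₁ p₂ ≤ (i : ℕ), a' i * h i (rightIndex j) :=
    Finset.sum_congr rfl fun i hi => by
      rw [ha i (Finset.mem_filter.mp hi).2]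
      ring
  have c3 : ∑ t ∈ Finset.univ.filter fun t : Fin p₂ => min p₁ p₂ ≤ (t : ℕ),
        k (leftIndex j) t * h (leftIndex j) t / σ j =
      ∑ t ∈ Finset.univ.filter fun t : Fin p₂ => min p₁ p₂ ≤ (t : ℕ), b' t * h (leftIndex j) t :=
    Finset.sum_congr rfl fun t ht => by
      rw [hb t (Finset.mem_filter.mp ht).2]
      ring
  rw [c1, c2, c3, hjj.1, hjj.2]
  ring

/-- Near `B` the `j`-th singular value is a `C²` function `l`, an eigenvalue of the dilation, with
the stated first and second derivative at `B`. -/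
theorem exists_contDiffAt_singularValue (hB : IsSVD B U σ V)
    (hinj : Function.Injective σ) (hpos : ∀ j, 0 < σ j) (j : Fin (min p₁ p₂)) :
    ∃ l : EuclideanSpace ℝ (Fin p₁ × Fin p₂) → ℝ,
      ContDiffAt ℝ 2 l (vecop B) ∧ l (vecop B) = σ j ∧
      (∀ᶠ x in 𝓝 (vecop B), ∃ w, w ≠ 0 ∧ hermitianDilation p₁ p₂ x w = l x • w) ∧
      (∀ H, fderiv ℝ l (vecop B) H = (Uᵀ * unvec H * V) (leftIndex j) (rightIndex j)) ∧
      ∀ K H, fderiv ℝ (fderiv ℝ l) (vecop B) K H =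
        singularValueHessian σ (Uᵀ * unvec K * V) (Uᵀ * unvec H * V) j := by
  set w₀ := sumVec (U.col (leftIndex j)) (V.col (rightIndex j)) with hw₀
  have hnorm : inner ℝ w₀ w₀ = 2 := by
    rw [hw₀, inner_sumVec_col,
      Matrix.transpose_mulVec_col_of_mem_orthogonalGroup hB.left_orthogonal,
      Matrix.transpose_mulVec_col_of_mem_orthogonalGroup hB.right_orthogonal]
    norm_num
  have hw₀0 : w₀ ≠ 0 := by
    intro h
    simp [h] at hnorm
  obtain ⟨w, l, hw, hl, hwB, hlB, hev⟩ := exists_contDiffAt_eigenpair (n := 2) two_ne_zero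
    (isSymmetric_hermitianDilation (vecop B)) hw₀0 (hB.hermitianDilation_col j)
    (hB.eq_smul_of_hermitianDilation_eq hinj hpos j)
  have hdw := hw.differentiableAt two_ne_zero
  have hdl := hl.differentiableAt two_ne_zero
  have hev1 := hev.mono fun x hx => hx.1
  have hd1 : ∀ H, fderiv ℝ l (vecop B) H =
      (Uᵀ * unvec H * V) (leftIndex j) (rightIndex j) := by
    intro H
    have := fderiv_eigenvalue_mul (isSymmetric_hermitianDilation _) hdw hdl hev1 H
    rw [hwB, hnorm, hw₀, hermitianDilation_sumVec, inner_sumVec_col,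
      transpose_mulVec_mulVec_col, transpose_mulVec_transpose_mulVec_col] at this
    linarith
  have horth : ∀ K, inner ℝ w₀ (fderiv ℝ w (vecop B) K) = 0 := by
    intro K
    have h1 := (innerSL ℝ w₀).hasFDerivAt.comp (vecop B) hdw.hasFDerivAt
    have h2 : (innerSL ℝ w₀) ∘ w =ᶠ[𝓝 (vecop B)] fun _ => inner ℝ w₀ w₀ :=
      hev.mono fun x hx => hx.2
    have h3 := h1.unique ((hasFDerivAt_const _ _).congr_of_eventuallyEq h2)
    simpa using congrArg (fun T : EuclideanSpace ℝ (Fin p₁ × Fin p₂) →L[ℝ] ℝ => T K) h3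
  refine ⟨l, hl, hlB, ?_, hd1, fun K H => ?_⟩
  · filter_upwards [hev] with x hx
    refine ⟨w x, ?_, hx.1⟩
    intro h
    have := hx.2
    rw [h, hnorm, inner_zero_right] at this
    norm_num at this
  · have h1 := fderiv_fderiv_eigenvalue_mul isSymmetric_hermitianDilation hw hl hev1
      (by rwa [hwB]) K H
    have h2 := apply_fderiv_eigenvector hdw hdl hev1 K
    rw [hwB, hnorm] at h1
    rw [hwB, hlB] at h2
    rw [← hB.inner_hermitianDilation_eq_singularValueHessian hinj hpos j K H _ _ (horth K) h2]
    linarith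

end IsSVD

end SVD

/-! ### The Hessian of a sum over the singular values -/

section Hessian

variable {p₁ p₂ : ℕ} {B : Matrix (Fin p₁) (Fin p₂) ℝ} {U : Matrix (Fin p₁) (Fin p₁) ℝ}
  {σ : Fin (min p₁ p₂) → ℝ} {V : Matrix (Fin p₂) (Fin p₂) ℝ} {f : ℝ → ℝ}

namespace IsSVD

/-- Near `B` the smooth eigenvalues `l j` of the dilation that continue the `σ j` stay distinct and
positive, hence they are all the singular values. -/
theorem singularValueSum_eventuallyEq
    {l : Fin (min p₁ p₂) → EuclideanSpace ℝ (Fin p₁ × Fin p₂) → ℝ}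
    (hinj : Function.Injective σ) (hpos : ∀ j, 0 < σ j)
    (hl : ∀ j, ContinuousAt (l j) (vecop B)) (hlB : ∀ j, l j (vecop B) = σ j)
    (hev : ∀ j, ∀ᶠ x in 𝓝 (vecop B), ∃ w, w ≠ 0 ∧ hermitianDilation p₁ p₂ x w = l j x • w)
    (f : ℝ → ℝ) :
    (fun x => singularValueSum f (unvec x)) =ᶠ[𝓝 (vecop B)] fun x => ∑ j, f (l j x) := by
  have h1 : ∀ᶠ x in 𝓝 (vecop B), ∀ j, 0 < l j x :=
    eventually_all.mpr fun j => (hl j).eventually (lt_mem_nhds (by rw [hlB]; exact hpos j))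
  have h2 : ∀ᶠ x in 𝓝 (vecop B), ∀ i j, i ≠ j → l i x ≠ l j x := by
    refine eventually_all.mpr fun i => eventually_all.mpr fun j => ?_
    by_cases hij : i = j
    · simp [hij]
    · have : l i (vecop B) ≠ l j (vecop B) := by
        rw [hlB, hlB]
        exact fun h => hij (hinj h)
      filter_upwards [((hl i).sub (hl j)).eventually_ne (sub_ne_zero.mpr this)] with x hx _
        using sub_ne_zero.mp hx
  filter_upwards [h1, h2, eventually_all.mpr hev] with x h1 h2 h3
  refine LinearMap.sum_singularValues_eq_of_hasEigenvalue _
    (fun i j hij => by_contra fun hne => h2 i j hne hij) h1 (fun j => ?_)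
    (finrank_range_toEuclideanLin_le _) f
  obtain ⟨w, hw, h⟩ := h3 j
  exact hasEigenvalue_gram_of_hermitianDilation (h1 j).ne' hw h

/-- The chain rule for `R = ∑ j, f ∘ l j` near `B`, the `l j` being the smooth singular values. -/
theorem contDiffAt_and_fderiv_fderiv_singularValueSum (hB : IsSVD B U σ V)
    (hinj : Function.Injective σ) (hpos : ∀ j, 0 < σ j) (hf : ContDiff ℝ 2 f) :
    ContDiffAt ℝ 2 (fun x : EuclideanSpace ℝ (Fin p₁ × Fin p₂) => singularValueSum f (unvec x))
        (vecop B) ∧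
      ∀ K H, fderiv ℝ (fderiv ℝ fun x => singularValueSum f (unvec x)) (vecop B) K H =
        ∑ j, (deriv (deriv f) (σ j) *
            ((Uᵀ * unvec K * V) (leftIndex j) (rightIndex j) *
              (Uᵀ * unvec H * V) (leftIndex j) (rightIndex j)) +
          deriv f (σ j) *
            singularValueHessian σ (Uᵀ * unvec K * V) (Uᵀ * unvec H * V) j) := by
  choose l hl hlB hev hd1 hd2 using hB.exists_contDiffAt_singularValue hinj hpos
  have hR := singularValueSum_eventuallyEq hinj hpos (fun j => (hl j).continuousAt) hlB hev f
  have hfl : ∀ j, ContDiffAt ℝ 2 (fun x => f (l j x)) (vecop B) := fun j =>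
    hf.contDiffAt.comp _ (hl j)
  refine ⟨(ContDiffAt.sum fun j _ => hfl j).congr_of_eventuallyEq hR, fun K H => ?_⟩
  have h1 : fderiv ℝ (fun x => singularValueSum f (unvec x)) =ᶠ[𝓝 (vecop B)]
      fun x => ∑ j, fderiv ℝ (fun x => f (l j x)) x := by
    filter_upwards [hR.eventuallyEq_nhds,
      eventually_all.mpr fun j => (hfl j).eventually (by simp)] with x hx hx'
    rw [hx.fderiv_eq, fderiv_fun_sum fun j _ => (hx' j).differentiableAt two_ne_zero]
  rw [h1.fderiv_eq, fderiv_fun_sum fun j _ =>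
    ((hfl j).fderiv_right (m := 1) (by norm_num)).differentiableAt one_ne_zero]
  simp only [sum_apply]
  refine Finset.sum_congr rfl fun j _ => ?_
  rw [ContDiffAt.fderiv_fderiv_comp hf (hl j), hd1, hd1, hd2, hlB]

end IsSVD

/-! ### The block form of the Hessian -/

theorem sum_sum_erase_comm {ι : Type*} [Fintype ι] [DecidableEq ι] (g : ι → ι → ℝ) :
    ∑ j, ∑ s ∈ Finset.univ.erase j, g j s = ∑ j, ∑ s ∈ Finset.univ.erase j, g s j :=
  Finset.sum_comm' fun _ _ => by simp [eq_comm]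

theorem sum_block2 (g : Fin (min p₁ p₂) → Fin (min p₁ p₂) → ℝ) :
    ∑ q : Block2 p₁ p₂, g q.1.1 q.1.2 = ∑ j, ∑ s ∈ Finset.univ.erase j, g j s := by
  rw [← Finset.sum_subtype (Finset.univ.filter fun q : Fin (min p₁ p₂) × Fin (min p₁ p₂) =>
    q.1 ≠ q.2) (by simp) fun q => g q.1 q.2, Finset.sum_filter, Fintype.sum_prod_type]
  refine Finset.sum_congr rfl fun j _ => ?_
  rw [← Finset.sum_filter]
  refine Finset.sum_congr ?_ fun _ _ => rfl
  ext s
  simp [eq_comm]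

theorem sum_block3 (g : Fin p₁ → Fin p₂ → ℝ) :
    ∑ q : Block3 p₁ p₂, g q.1.1 q.1.2 =
      ∑ j, ((∑ i ∈ Finset.univ.filter fun i : Fin p₁ => min p₁ p₂ ≤ (i : ℕ),
          g i (rightIndex j)) +
        ∑ t ∈ Finset.univ.filter fun t : Fin p₂ => min p₁ p₂ ≤ (t : ℕ), g (leftIndex j) t) := by
  rw [← Finset.sum_subtype (Finset.univ.filter fun q : Fin p₁ × Fin p₂ =>
    min p₁ p₂ ≤ (q.1 : ℕ) ∨ min p₁ p₂ ≤ (q.2 : ℕ)) (by simp) fun q => g q.1 q.2,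
    Finset.sum_filter, Fintype.sum_prod_type, Fin.sum_eq_sum_castLE_add (min_le_left p₁ p₂),
    Finset.sum_add_distrib, add_comm]
  congr 1
  · refine Eq.trans ?_ Finset.sum_comm
    refine Finset.sum_congr rfl fun i hi => ?_
    have hi' : min p₁ p₂ ≤ (i : ℕ) := (Finset.mem_filter.mp hi).2
    rw [Fin.sum_eq_sum_castLE_add (min_le_right p₁ p₂),
      Finset.filter_false_of_mem (p := fun t : Fin p₂ => min p₁ p₂ ≤ (t : ℕ)) fun t _ => ?_,
      Finset.sum_empty, add_zero]
    · simp [hi']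
    · -- Only one of the two dimensions can exceed the smaller one.
      omega
  · refine Finset.sum_congr rfl fun j _ => ?_
    rw [Finset.sum_filter]
    refine Finset.sum_congr rfl fun t _ => ?_
    have : ¬ min p₁ p₂ ≤ ((j.castLE (min_le_left p₁ p₂) : Fin p₁) : ℕ) := not_le.mpr j.isLt
    simp only [this, false_or]

theorem blockA2_mulVec (h : Matrix (Fin p₁) (Fin p₂) ℝ) (q : Block2 p₁ p₂) :
    (blockA2 f σ *ᵥ fun b => h (leftIndex b.1.1) (rightIndex b.1.2)) q =
      (σ q.1.1 * deriv f (σ q.1.1) - σ q.1.2 * deriv f (σ q.1.2)) /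
          (σ q.1.1 ^ 2 - σ q.1.2 ^ 2) * h (leftIndex q.1.1) (rightIndex q.1.2) -
        (σ q.1.1 * deriv f (σ q.1.2) - σ q.1.2 * deriv f (σ q.1.1)) /
          (σ q.1.1 ^ 2 - σ q.1.2 ^ 2) * h (leftIndex q.1.2) (rightIndex q.1.1) := by
  obtain ⟨⟨s, t⟩, hst⟩ := q
  have hst' : s ≠ t := hst
  rw [Matrix.mulVec, dotProduct, Fintype.sum_eq_add ⟨(s, t), hst⟩ ⟨(t, s), hst.symm⟩]
  · simp [blockA2, hst', hst'.symm, sub_eq_add_neg]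
  · simp [hst']
  · rintro ⟨b, hb⟩ ⟨h1, h2⟩
    have h1' : b ≠ (s, t) := fun e => h1 (Subtype.ext e)
    have h2' : b ≠ (t, s) := fun e => h2 (Subtype.ext e)
    simp [blockA2, h1', h2']

/-- The second derivative of `∑ j, f (σ_j)`, collected by the label of `k`, is the bilinear form of
the block matrix. -/
theorem sum_singularValueHessian_eq_dotProduct_blockMatrix (f : ℝ → ℝ)
    (σ : Fin (min p₁ p₂) → ℝ) (k h : Matrix (Fin p₁) (Fin p₂) ℝ) :
    ∑ j, (deriv (deriv f) (σ j) *
        (k (leftIndex j) (rightIndex j) * h (leftIndex j) (rightIndex j)) +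
          deriv f (σ j) * IsSVD.singularValueHessian σ k h j) =
      (fun c => k (blockPos c).1 (blockPos c).2) ⬝ᵥ
        (blockMatrix f σ *ᵥ fun c => h (blockPos c).1 (blockPos c).2) := by
  have hh : (fun c : BlockIndex p₁ p₂ => h (blockPos c).1 (blockPos c).2) =
      Sum.elim (fun s => h (leftIndex s) (rightIndex s))
        (Sum.elim (fun q => h (leftIndex q.1.1) (rightIndex q.1.2)) fun q => h q.1.1 q.1.2) := by
    ext (s | q | q) <;> rfl
  rw [hh, dotProduct, Fintype.sum_sum_type, Fintype.sum_sum_type]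
  simp only [blockMatrix, Matrix.fromBlocks_mulVec, Sum.elim_inl, Sum.elim_inr,
    Sum.elim_comp_inl, Sum.elim_comp_inr, Matrix.zero_mulVec, add_zero, zero_add, blockPos,
    blockA2_mulVec, blockA1, blockA3, Matrix.mulVec_diagonal]
  rw [sum_block2 fun s t => k (leftIndex s) (rightIndex t) *
      ((σ s * deriv f (σ s) - σ t * deriv f (σ t)) / (σ s ^ 2 - σ t ^ 2) *
          h (leftIndex s) (rightIndex t) -
        (σ s * deriv f (σ t) - σ t * deriv f (σ s)) / (σ s ^ 2 - σ t ^ 2) *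
          h (leftIndex t) (rightIndex s)),
    sum_block3 fun i t => k i t *
      (deriv f (σ ⟨min (i : ℕ) (t : ℕ), min_lt_min i.isLt t.isLt⟩) /
        σ ⟨min (i : ℕ) (t : ℕ), min_lt_min i.isLt t.isLt⟩ * h i t)]
  simp only [IsSVD.singularValueHessian, mul_add, Finset.sum_add_distrib, ← add_assoc,
    Finset.mul_sum]
  refine congrArg₂ (· + ·) (congrArg₂ (· + ·) (congrArg₂ (· + ·) ?_ ?_) ?_) ?_
  · exact Finset.sum_congr rfl fun j _ => by ring
  · -- The terms with a factor `k (s, j)` and those with a factor `k (j, s)` are separated; in the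
    -- former `j` and `s` are exchanged, so that the labels of `k` agree.
    let α : Fin (min p₁ p₂) → Fin (min p₁ p₂) → ℝ := fun j s =>
      deriv f (σ j) * (σ j * h (leftIndex s) (rightIndex j) +
        σ s * h (leftIndex j) (rightIndex s)) / (σ j ^ 2 - σ s ^ 2) *
        k (leftIndex s) (rightIndex j)
    let β : Fin (min p₁ p₂) → Fin (min p₁ p₂) → ℝ := fun j s =>
      deriv f (σ j) * (σ s * h (leftIndex s) (rightIndex j) +
        σ j * h (leftIndex j) (rightIndex s)) / (σ j ^ 2 - σ s ^ 2) *
        k (leftIndex j) (rightIndex s)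
    trans ∑ j, ∑ s ∈ Finset.univ.erase j, α j s + ∑ j, ∑ s ∈ Finset.univ.erase j, β j s
    · simp only [← Finset.sum_add_distrib, α, β]
      refine Finset.sum_congr rfl fun j _ => Finset.sum_congr rfl fun s _ => ?_
      ring
    · rw [sum_sum_erase_comm α]
      simp only [← Finset.sum_add_distrib, α, β]
      refine Finset.sum_congr rfl fun j _ => Finset.sum_congr rfl fun s _ => ?_
      rw [← neg_sub (σ j ^ 2) (σ s ^ 2), div_neg]
      ring
  · refine Finset.sum_congr rfl fun j _ => Finset.sum_congr rfl fun i hi => ?_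
    have : (⟨min (i : ℕ) (rightIndex j : ℕ), min_lt_min i.isLt (rightIndex j).isLt⟩ :
        Fin (min p₁ p₂)) = j :=
      Fin.ext (min_eq_right (j.isLt.le.trans (Finset.mem_filter.mp hi).2))
    rw [this]
    ring
  · refine Finset.sum_congr rfl fun j _ => Finset.sum_congr rfl fun t ht => ?_
    have : (⟨min (leftIndex j : ℕ) (t : ℕ), min_lt_min (leftIndex j).isLt t.isLt⟩ :
        Fin (min p₁ p₂)) = j :=
      Fin.ext (min_eq_left (j.isLt.le.trans (Finset.mem_filter.mp ht).2))
    rw [this]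
    ring

/-- The rows of `Q` are the coordinate directions, expressed in the bases of singular vectors. -/
theorem basisMatrix_apply (U : Matrix (Fin p₁) (Fin p₁) ℝ) (V : Matrix (Fin p₂) (Fin p₂) ℝ)
    (a : Fin p₁ × Fin p₂) (c : BlockIndex p₁ p₂) :
    basisMatrix U V a c =
      (Uᵀ * unvec (EuclideanSpace.single a 1) * V) (blockPos c).1 (blockPos c).2 := by
  have : unvec (EuclideanSpace.single a (1 : ℝ)) = Matrix.single a.1 a.2 1 := by
    ext i t
    simp [unvec, Matrix.single_apply, Prod.ext_iff, eq_comm]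
  rw [this, Matrix.mul_assoc]
  simp [basisMatrix, vecop, Matrix.vecMulVec_apply, Matrix.mul_apply, Matrix.single_apply, ite_and]

theorem blockPos_bijective : Function.Bijective (blockPos : BlockIndex p₁ p₂ → _) := by
  constructor
  · rintro (s | ⟨⟨s, t⟩, h⟩ | ⟨⟨i, t⟩, h⟩) (s' | ⟨⟨s', t'⟩, h'⟩ | ⟨⟨i', t'⟩, h'⟩) heq <;>
      simp only [blockPos, Prod.mk.injEq, Fin.ext_iff, Fin.val_castLE, ne_eq] at * <;>
      grind
  · rintro ⟨i, t⟩
    by_cases h : min p₁ p₂ ≤ (i : ℕ) ∨ min p₁ p₂ ≤ (t : ℕ)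
    · exact ⟨Sum.inr (Sum.inr ⟨(i, t), h⟩), rfl⟩
    · rw [not_or, not_le, not_le] at h
      by_cases hit : (i : ℕ) = t
      · exact ⟨Sum.inl ⟨i, h.1⟩, Prod.ext rfl (Fin.ext hit)⟩
      · exact ⟨Sum.inr (Sum.inl ⟨(⟨i, h.1⟩, ⟨t, h.2⟩), fun e => hit (Fin.mk.inj_iff.mp e)⟩), rfl⟩

/-- Up to relabelling its columns, `Q` is the Kronecker product of `U` and `V`. -/
theorem basisMatrix_orthogonal (hB : IsSVD B U σ V) :
    (basisMatrix U V)ᵀ * basisMatrix U V = 1 ∧ basisMatrix U V * (basisMatrix U V)ᵀ = 1 := by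
  let e := Equiv.ofBijective _ (blockPos_bijective (p₁ := p₁) (p₂ := p₂))
  have hQ : basisMatrix U V = (U ⊗ₖ V).submatrix id e := by
    ext a c
    rfl
  have hT : (U ⊗ₖ V)ᵀ = Uᵀ ⊗ₖ Vᵀ := rfl
  rw [hQ, Matrix.transpose_submatrix]
  constructor
  · rw [← Matrix.submatrix_mul _ _ _ _ _ Function.bijective_id, hT, ← Matrix.mul_kronecker_mul,
      Matrix.transpose_mul_self_of_mem_orthogonalGroup hB.left_orthogonal,
      Matrix.transpose_mul_self_of_mem_orthogonalGroup hB.right_orthogonal,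
      Matrix.one_kronecker_one, Matrix.submatrix_one_equiv]
  · rw [← Matrix.submatrix_mul _ _ _ _ _ e.bijective, hT, ← Matrix.mul_kronecker_mul,
      Matrix.self_mul_transpose_of_mem_orthogonalGroup hB.left_orthogonal,
      Matrix.self_mul_transpose_of_mem_orthogonalGroup hB.right_orthogonal,
      Matrix.one_kronecker_one, Matrix.submatrix_id_id]

end Hessian

end

theorem mainTheorem8 (p₁ p₂ : ℕ) (f : ℝ → ℝ) (hf : ContDiff ℝ 2 f)
    (B : Matrix (Fin p₁) (Fin p₂) ℝ) (U : Matrix (Fin p₁) (Fin p₁) ℝ)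
    (σ : Fin (min p₁ p₂) → ℝ) (V : Matrix (Fin p₂) (Fin p₂) ℝ) (hB : IsSVD B U σ V)
    (hdistinct : Function.Injective σ) (hne : ∀ j, σ j ≠ 0) :
    ContDiffAt ℝ 2 (fun x : EuclideanSpace ℝ (Fin p₁ × Fin p₂) => singularValueSum f (unvec x))
        (vecop B) ∧
      (basisMatrix U V).transpose * basisMatrix U V = 1 ∧
      basisMatrix U V * (basisMatrix U V).transpose = 1 ∧
      hessianMatrix
          (fun x : EuclideanSpace ℝ (Fin p₁ × Fin p₂) => singularValueSum f (unvec x)) (vecop B) =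
        basisMatrix U V * blockMatrix f σ * (basisMatrix U V).transpose := by
  have hpos : ∀ j, 0 < σ j := fun j => (hB.nonneg j).lt_of_ne' (hne j)
  obtain ⟨hsmooth, hhess⟩ :=
    hB.contDiffAt_and_fderiv_fderiv_singularValueSum hdistinct hpos hf
  refine ⟨hsmooth, (basisMatrix_orthogonal hB).1, (basisMatrix_orthogonal hB).2, ?_⟩
  ext a b
  rw [hessianMatrix, Matrix.of_apply, hhess,
    sum_singularValueHessian_eq_dotProduct_blockMatrix f σ,
    Matrix.mul_assoc (basisMatrix U V)]
  simp only [← basisMatrix_apply]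
  rfl
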